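/- Let $k\ge 2$ be an integer and let $(x_n)_{n\ge 1}\subseteq[0,1]$ be a sequence. For real $t$ write $\{t\}$ for its fractional part and put $(\!(t)\!)=\{t\}$ if $\{t\}\le\frac12$ and $(\!(t)\!)=\{t\}-1$ otherwise. For $s>0$ and $N\ge1$ let $$R_k(s,N)=\frac1N\sum_{\substack{i_1,\dots,i_k\le N\\ \text{pairwise distinct}}}\mathbf 1_{[-s,s]^{k-1}}\Big(N(\!(x_{i_1}-x_{i_2})\!),\,N(\!(x_{i_1}-x_{i_3})\!),\dots,N(\!(x_{i_1}-x_{i_k})\!)\Big).$$ Let $G:[0,1]\to\mathbb R$ be an asymptotic distribution function of $(x_n)$ along $(N_j)$: that is, $(N_j)_j$ is a strictly increasing sequence of positive integers, and for every $t\in[0,1]$ $$G(t)=\lim_{j\to\infty}\frac1{N_j}\#\{n\le N_j:0\le x_n\le t\}.$$ Then: (i) If $G$ is not absolutely continuous on $[0,1]$, or if $G(0)>0$, then $\lim_{j\to\infty}R_k(s,N_j)=\infty$ for every $s>0$. (ii) If $G$ is absolutely continuous on $[0,1]$, then $G$ has a density on $[0,1]$, that is, there is an integrable, almost everywhere non-negative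 function $g$ on $[0,1]$ with $G(b)-G(a)=\int_a^b g(t)\,\mathrm dt$ for all $0\le a\le b\le1$; and every such $g$ satisfies $$\limsup_{s\to\infty}\frac{\limsup_{j\to\infty}R_k(s,N_j)}{(2s)^{k-1}}\ \ge\ \int_0^1 g(t)^k\,\mathrm dt ,$$ where both sides are elements of $[0,\infty]$. -/

import Mathlib

open Filter MeasureTheory Set

noncomputable section

/-- The signed distance `((t))` of a real number `t` from the origin modulo `1`. -/
def signedDistMod (t : ℝ) : ℝ :=
  if Int.fract t ≤ 1 / 2 then Int.fract t else Int.fract t - 1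

/-- The correlation function of order `m + 1` of the sequence `x 1, x 2, …` with respect to the
test function `f : ℝ ^ m → ℝ`:
`(1 / N) ∑ f (N ((x_{i_0} - x_{i_1})), …, N ((x_{i_0} - x_{i_m})))`, the sum running over all
tuples `(i_0, …, i_m)` of pairwise distinct indices in `{1, …, N}`. -/
def correlationFn (m : ℕ) (x : ℕ → ℝ) (f : (Fin m → ℝ) → ℝ) (N : ℕ) : ℝ :=
  open Classical in
  (1 / (N : ℝ)) *
    ∑ i ∈ (Fintype.piFinset fun _ : Fin (m + 1) => Finset.Icc 1 N).filter Function.Injective,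
      f fun r : Fin m => (N : ℝ) * signedDistMod (x (i 0) - x (i r.succ))

/-- `R_k(s, N)`, for `k ≥ 2`: the `k`-th order correlation function of `x` with respect to the
indicator function of the cube `[-s, s] ^ (k - 1)`. -/
def boxCorrelation (k : ℕ) (x : ℕ → ℝ) (s : ℝ) (N : ℕ) : ℝ :=
  correlationFn (k - 1) x
    (Set.indicator (Set.univ.pi fun _ : Fin (k - 1) => Set.Icc (-s) s) fun _ => (1 : ℝ)) N

/-- `G` (only its values on `[0, 1]` matter) is the asymptotic distribution function of
`x 1, x 2, …` along the strictly increasing sequence of integers `N`. -/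
def IsAsymptoticDistributionAlong (x : ℕ → ℝ) (N : ℕ → ℕ) (G : ℝ → ℝ) : Prop :=
  StrictMono N ∧ ∀ t ∈ Set.Icc (0 : ℝ) 1,
    Tendsto (fun j => (Set.ncard {n : ℕ | 1 ≤ n ∧ n ≤ N j ∧ 0 ≤ x n ∧ x n ≤ t} : ℝ) / (N j : ℝ))
      atTop (nhds (G t))

/-- `g` is a density on `[0, 1]` of the Lebesgue–Stieltjes measure of `G`, i.e. of the measure
that gives mass `G b - G a` to the interval `(a, b]` for `0 ≤ a ≤ b ≤ 1`. -/
structure IsDensityOf (g G : ℝ → ℝ) : Prop where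
  integrableOn : IntegrableOn g (Set.Icc 0 1)
  nonneg : ∀ᵐ t ∂(volume.restrict (Set.Icc (0 : ℝ) 1)), 0 ≤ g t
  integral_eq : ∀ a b : ℝ, 0 ≤ a → a ≤ b → b ≤ 1 → ∫ t in Set.Ioc a b, g t = G b - G a

end

/-!
Fix the first index `i` of a tuple. The remaining `k - 1` indices range over the points within
`s / N` of `x i`, so that `N * R_k(s, N)` is the sum over `i` of a falling factorial of the number
of neighbours of `x i`, which is at least a `(k - 1)`-st power up to a bounded shift. The power is
bounded below by its tangent at a point that may depend on the part of `[0, 1]` in which `x i` lies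
(`sum_tangent_le_boxCorrelation`). This is linear in the number of neighbours and reduces
everything to counting pairs of close points inside disjoint sets of indices.

Pairs are counted by cutting the line into cells of length `σ / N`: points whose cells have indices
differing by at most `q` are at distance at most `(q + 1) σ / N`. At a single scale the pair count
can be smaller, by a factor close to `2`, than it is for evenly spread points, and this is where an
upper limit in `s` is needed. Summed over `q < Q`, however, the number of pairs is a sum of squares
of the numbers of points in windows of `Q` consecutive cells (`sum_closePairs_ge`), because
`max (Q - |i - j|) 0` counts the windows that contain both cells `i` and `j`. The Cauchy-Schwarz
inequality, used in its tangent form `c ^ 2 ≥ 2 * b * c - b ^ 2`, then gives the sharp constant.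

If `G` is not absolutely continuous, or jumps at `0`, then a fixed proportion of the points lies in
finitely many intervals of arbitrarily small total length. One scale (`Q = 1`) suffices here, and
the tangent bound is as large as desired (`tendsto_boxCorrelation_atTop`).

If `G` is absolutely continuous, its density exists by the fundamental theorem of calculus. Suppose
that the correlations at all large scales are at most `c * (2 * s) ^ (k - 1)`. With tangent points
proportional to the scale, summing over the scales `s = 1, …, Q` and letting first `N` and then `Q`
tend to infinity yields `∑ |I| * (ΔG(I) / |I|) ^ k ≤ c` for every finite family of disjoint
intervals `I` (`sum_moment_le_of_boxCorrelation_le`). By Lebesgue's differentiation theorem the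
difference quotients over the partitions of `[0, 1]` into equal intervals converge to the density
almost everywhere, and Fatou's lemma gives `∫ g ^ k ≤ c` (`IsDensityOf.lintegral_pow_le`).
-/

/-! ### Counting tuples through neighbours -/

lemma abs_signedDistMod_le (t : ℝ) : |signedDistMod t| ≤ |t| := by
  have h0 := Int.fract_nonneg t
  have h1 := Int.fract_lt_one t
  have hfl := Int.floor_add_fract t
  have key : |signedDistMod t| ≤ 1 / 2 := by
    unfold signedDistMod
    split_ifs with h <;> rw [abs_le] <;> constructor <;> linarith
  rcases le_or_gt (1 / 2) |t| with h | h
  · exact key.trans h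
  rw [abs_lt] at h
  rcases le_or_gt 0 t with ht | ht
  · have : Int.fract t = t := Int.fract_eq_self.2 ⟨ht, by linarith⟩
    unfold signedDistMod
    rw [this, if_pos (by linarith)]
  · have : Int.fract t = t + 1 := by
      rw [Int.fract_eq_iff]
      exact ⟨by linarith, by linarith, -1, by push_cast; ring⟩
    unfold signedDistMod
    rw [this, if_neg (by linarith)]
    simp

/-- The indices `j ≠ i` in `{1, …, N}` whose points lie within `s / N` of `x i` modulo `1`. -/
noncomputable def boxNeighbours (x : ℕ → ℝ) (N : ℕ) (s : ℝ) (i : ℕ) : Finset ℕ :=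
  open Classical in
  (Finset.Icc 1 N).filter fun j => j ≠ i ∧ (N : ℝ) * signedDistMod (x i - x j) ∈ Set.Icc (-s) s

/-- The tuples counted by the correlation function that start with `i` are at least as many as the
injections of the remaining `r` positions into the neighbours of `i`. -/
lemma sum_descFactorial_le_boxCorrelation (r : ℕ) (x : ℕ → ℝ) (s : ℝ) {N : ℕ} (hN : 0 < N) :
    ∑ i ∈ Finset.Icc 1 N, (((boxNeighbours x N s i).card.descFactorial r : ℕ) : ℝ) ≤
      N * boxCorrelation (r + 1) x s N := by
  classical
  have hN' : (N : ℝ) ≠ 0 := by positivity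
  unfold boxCorrelation correlationFn
  rw [← mul_assoc, mul_one_div_cancel hN', one_mul]
  simp only [Set.indicator_apply]
  rw [← Finset.sum_filter, Finset.sum_const, nsmul_eq_mul, mul_one, ← Nat.cast_sum, Nat.cast_le]
  rw [Finset.card_eq_sum_card_fiberwise (f := fun i => i 0) (t := Finset.Icc 1 N)]
  · refine Finset.sum_le_sum fun i hi => ?_
    have hcard : (boxNeighbours x N s i).card.descFactorial r =
        (Finset.univ : Finset (Fin r ↪ boxNeighbours x N s i)).card := by
      rw [Finset.card_univ, Fintype.card_embedding_eq, Fintype.card_coe, Fintype.card_fin]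
    rw [hcard]
    refine Finset.card_le_card_of_injOn
      (fun e => (Fin.cons i fun l => (e l : ℕ) : Fin (r + 1) → ℕ)) ?_ ?_
    · intro e _
      have he : ∀ l, (e l : ℕ) ∈ Finset.Icc 1 N ∧ (e l : ℕ) ≠ i ∧
          (N : ℝ) * signedDistMod (x i - x (e l)) ∈ Set.Icc (-s) s := by
        intro l
        have := (e l).2
        simpa only [boxNeighbours, Finset.mem_filter] using this
      have hinj : Function.Injective (Fin.cons i fun l => (e l : ℕ) : Fin (r + 1) → ℕ) := by
        rw [Fin.cons_injective_iff]
        refine ⟨?_, fun a b hab => e.injective (Subtype.ext hab)⟩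
        rintro ⟨l, hl⟩
        exact (he l).2.1 hl
      refine Finset.mem_coe.2 (Finset.mem_filter.2 ⟨Finset.mem_filter.2 ⟨Finset.mem_filter.2
        ⟨Fintype.mem_piFinset.2 ?_, hinj⟩, ?_⟩, rfl⟩)
      · intro l
        refine Fin.cases ?_ ?_ l
        · exact hi
        · intro l
          exact (he l).1
      · intro l _
        exact (he l).2.2
    · intro e _ e' _ h
      have := (Fin.cons_injective2 h).2
      ext l
      exact congrFun this l
  · intro i hi
    simp only [Finset.coe_filter, Finset.mem_filter, Fintype.mem_piFinset, Set.mem_ofPred_eq] at hi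
    exact Finset.mem_coe.2 (hi.1.1 0)

lemma boxCorrelation_mono (r : ℕ) (x : ℕ → ℝ) (N : ℕ) {s t : ℝ} (hst : s ≤ t) :
    boxCorrelation (r + 1) x s N ≤ boxCorrelation (r + 1) x t N := by
  classical
  unfold boxCorrelation correlationFn
  refine mul_le_mul_of_nonneg_left (Finset.sum_le_sum fun i _ => ?_) (by positivity)
  exact Set.indicator_le_indicator_of_subset
    (Set.pi_mono fun _ _ => Set.Icc_subset_Icc (neg_le_neg hst) hst) (fun _ => zero_le_one) _

/-- The tangent to `y ↦ y ^ (n + 1)` at `A` lies below the graph. -/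
lemma tangent_le_pow (n : ℕ) {A y : ℝ} (hA : 0 ≤ A) (hy : 0 ≤ y) :
    (n + 1 : ℝ) * A ^ n * y - n * A ^ (n + 1) ≤ y ^ (n + 1) := by
  induction n with
  | zero => simp
  | succ n ih =>
    have h1 := mul_le_mul_of_nonneg_left ih hy
    have h2 : 0 ≤ (n + 1 : ℝ) * A ^ n * (y - A) ^ 2 := by positivity
    have h3 : y ^ (n + 1 + 1) = y * y ^ (n + 1) := by ring
    push_cast
    rw [h3]
    refine le_trans (le_of_sub_nonneg ?_) h1
    have : y * ((n + 1 : ℝ) * A ^ n * y - n * A ^ (n + 1)) -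
        ((n + 1 + 1 : ℝ) * A ^ (n + 1) * y - (n + 1) * A ^ (n + 1 + 1)) =
        (n + 1 : ℝ) * A ^ n * (y - A) ^ 2 := by ring
    rw [this]
    exact h2

lemma tangent_le_descFactorial (n : ℕ) {A : ℝ} (hA : 0 ≤ A) {h c : ℕ} (hc : h ≤ c + 1) :
    (n + 1 : ℝ) * A ^ n * (h - (n + 1)) - n * A ^ (n + 1) ≤
      ((c.descFactorial (n + 1) : ℕ) : ℝ) := by
  have h1 : (h : ℝ) - (n + 1) ≤ ((c + 1 - (n + 1) : ℕ) : ℝ) := by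
    have : h ≤ (c + 1 - (n + 1)) + (n + 1) := by omega
    have : (h : ℝ) ≤ ((c + 1 - (n + 1) : ℕ) : ℝ) + (n + 1) := by exact_mod_cast this
    linarith
  have h2 := Nat.pow_sub_le_descFactorial c (n + 1)
  have h3 : (((c + 1 - (n + 1) : ℕ) : ℝ)) ^ (n + 1) ≤ ((c.descFactorial (n + 1) : ℕ) : ℝ) := by
    exact_mod_cast h2
  refine le_trans ?_ ((tangent_le_pow n hA (Nat.cast_nonneg _)).trans h3)
  gcongr

/-! ### Pairs of points in neighbouring cells -/

/-- The number of ordered pairs of indices in `F`, equal indices included, whose labels differ by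
at most `q`. -/
noncomputable def closePairs (κ : ℕ → ℤ) (F : Finset ℕ) (q : ℕ) : ℕ :=
  ∑ i ∈ F, (F.filter fun j => |κ i - κ j| ≤ q).card

/-- Summed over `q < Q`, the pairs with labels differing by at most `q` are the pairs contained in
a window of `Q` consecutive labels, counted once for each window. The squares of the window counts
are then bounded below by their tangents at `b`. -/
lemma sum_closePairs_ge (κ : ℕ → ℤ) (F : Finset ℕ) (Q : ℕ) (U : Finset ℤ)
    (hU : ∀ i ∈ F, Finset.Ioc (κ i - Q) (κ i) ⊆ U) (b : ℝ) :
    2 * b * Q * F.card - b ^ 2 * U.card ≤ ∑ q ∈ Finset.range Q, (closePairs κ F q : ℝ) := by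
  set c : ℤ → ℕ := fun u => (F.filter fun i => u ∈ Finset.Ioc (κ i - Q) (κ i)).card with hc
  have hsum : ∑ u ∈ U, c u = Q * F.card := by
    simp only [hc, Finset.card_filter]
    rw [Finset.sum_comm]
    rw [Finset.sum_congr rfl (g := fun _ => Q), Finset.sum_const, smul_eq_mul, mul_comm]
    intro i hi
    rw [← Finset.card_filter, Finset.filter_mem_eq_inter, Finset.inter_eq_right.2 (hU i hi)]
    simp
  have hsq : ∑ u ∈ U, c u ^ 2 ≤ ∑ q ∈ Finset.range Q, closePairs κ F q := by
    have e1 : ∑ u ∈ U, c u ^ 2 = ∑ i ∈ F, ∑ j ∈ F, (U.filter fun u =>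
        u ∈ Finset.Ioc (κ i - Q) (κ i) ∧ u ∈ Finset.Ioc (κ j - Q) (κ j)).card := by
      simp only [hc, Finset.card_filter, sq, Finset.sum_mul_sum]
      rw [Finset.sum_comm]
      refine Finset.sum_congr rfl fun i _ => ?_
      rw [Finset.sum_comm]
      refine Finset.sum_congr rfl fun j _ => ?_
      refine Finset.sum_congr rfl fun u _ => ?_
      by_cases h1 : u ∈ Finset.Ioc (κ i - Q) (κ i) <;>
        by_cases h2 : u ∈ Finset.Ioc (κ j - Q) (κ j) <;> simp [h1, h2]
    have e2 : ∑ q ∈ Finset.range Q, closePairs κ F q = ∑ i ∈ F, ∑ j ∈ F,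
        ((Finset.range Q).filter fun q : ℕ => |κ i - κ j| ≤ q).card := by
      simp only [closePairs, Finset.card_filter]
      rw [Finset.sum_comm]
      refine Finset.sum_congr rfl fun i _ => ?_
      rw [Finset.sum_comm]
    rw [e1, e2]
    refine Finset.sum_le_sum fun i _ => Finset.sum_le_sum fun j _ => ?_
    refine Finset.card_le_card_of_injOn (fun u => (max (κ i) (κ j) - u).toNat) ?_ ?_
    · intro u hu
      simp only [Finset.coe_filter, Finset.mem_Ioc, Set.mem_ofPred_eq, Finset.mem_range] at hu ⊢
      constructor
      · rcases le_total (κ i) (κ j) with h | h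
        · rw [max_eq_right h]; omega
        · rw [max_eq_left h]; omega
      · rcases le_total (κ i) (κ j) with h | h
        · rw [max_eq_right h, abs_le]; omega
        · rw [max_eq_left h, abs_le]; omega
    · intro u hu v hv huv
      simp only [Finset.coe_filter, Finset.mem_Ioc, Set.mem_ofPred_eq] at hu hv huv
      have h1 := le_max_left (κ i) (κ j)
      omega
  have hsum' : ∑ u ∈ U, (c u : ℝ) = Q * F.card := by exact_mod_cast hsum
  have hsq' : ∑ u ∈ U, (c u : ℝ) ^ 2 ≤ ∑ q ∈ Finset.range Q, (closePairs κ F q : ℝ) := by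
    exact_mod_cast hsq
  refine le_trans ?_ hsq'
  have : 2 * b * Q * F.card - b ^ 2 * U.card = ∑ u ∈ U, (2 * b * c u - b ^ 2) := by
    rw [Finset.sum_sub_distrib, ← Finset.mul_sum, hsum', Finset.sum_const, nsmul_eq_mul]
    ring
  rw [this]
  refine Finset.sum_le_sum fun u _ => ?_
  nlinarith [sq_nonneg ((c u : ℝ) - b)]

/-- The index of the cell of length `σ / N` that contains `x i`. -/
noncomputable def cellIndex (x : ℕ → ℝ) (σ : ℝ) (N : ℕ) (i : ℕ) : ℤ := ⌊x i * N / σ⌋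

lemma sum_closePairs_cellIndex_ge (x : ℕ → ℝ) {σ : ℝ} (hσ : 0 < σ) (N : ℕ) {a b : ℝ}
    (hab : a ≤ b) (F : Finset ℕ) (hF : ∀ i ∈ F, x i ∈ Set.Icc a b) (Q : ℕ) (B : ℝ) :
    2 * B * Q * F.card - B ^ 2 * ((b - a) * N / σ + Q + 1) ≤
      ∑ q ∈ Finset.range Q, (closePairs (cellIndex x σ N) F q : ℝ) := by
  have hmono : a * N / σ ≤ b * N / σ := by gcongr
  set U := Finset.Icc (⌊a * N / σ⌋ - Q + 1) ⌊b * N / σ⌋ with hUdef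
  have hU : (U.card : ℝ) ≤ (b - a) * N / σ + Q + 1 := by
    have h1 : (U.card : ℤ) = ⌊b * N / σ⌋ - ⌊a * N / σ⌋ + Q := by
      have := Int.floor_le_floor hmono
      rw [hUdef, Int.card_Icc, Int.toNat_of_nonneg] <;> omega
    have h2 : (U.card : ℝ) = ⌊b * N / σ⌋ - ⌊a * N / σ⌋ + Q := by exact_mod_cast h1
    have h3 := Int.floor_le (b * N / σ)
    have h4 := Int.lt_floor_add_one (a * N / σ)
    have h5 : (b - a) * N / σ = b * N / σ - a * N / σ := by ring
    linarith
  refine le_trans ?_ (sum_closePairs_ge (cellIndex x σ N) F Q U ?_ B)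
  · have := mul_le_mul_of_nonneg_left hU (sq_nonneg B)
    linarith
  · intro i hi u hu
    have h1 : ⌊a * N / σ⌋ ≤ cellIndex x σ N i :=
      Int.floor_le_floor (by have := (hF i hi).1; gcongr)
    have h2 : cellIndex x σ N i ≤ ⌊b * N / σ⌋ :=
      Int.floor_le_floor (by have := (hF i hi).2; gcongr)
    rw [Finset.mem_Ioc] at hu
    rw [hUdef, Finset.mem_Icc]
    omega

/-- Points in cells at distance at most `q` are at distance at most `(q + 1) σ / N`. -/
lemma card_close_le_card_boxNeighbours (x : ℕ → ℝ) {σ : ℝ} (hσ : 0 < σ) (N : ℕ) (q : ℕ)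
    {F : Finset ℕ} (hF : F ⊆ Finset.Icc 1 N) (i : ℕ) :
    (F.filter fun j => |cellIndex x σ N i - cellIndex x σ N j| ≤ q).card ≤
      (boxNeighbours x N ((q + 1) * σ) i).card + 1 := by
  classical
  refine (Finset.card_le_card ?_).trans (Finset.card_insert_le i _)
  intro j hj
  rw [Finset.mem_filter] at hj
  rw [Finset.mem_insert]
  by_cases hji : j = i
  · exact Or.inl hji
  right
  refine Finset.mem_filter.2 ⟨hF hj.1, hji, ?_⟩
  rw [Set.mem_Icc, ← abs_le, abs_mul, abs_of_nonneg (Nat.cast_nonneg N)]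
  refine le_trans (mul_le_mul_of_nonneg_left (abs_signedDistMod_le _) (Nat.cast_nonneg N)) ?_
  have h1 : |(cellIndex x σ N i : ℝ) - cellIndex x σ N j| ≤ q := by exact_mod_cast hj.2
  have h2 : |x i * N / σ - x j * N / σ| ≤ q + 1 := by
    have a1 := Int.floor_le (x i * N / σ)
    have a2 := Int.lt_floor_add_one (x i * N / σ)
    have a3 := Int.floor_le (x j * N / σ)
    have a4 := Int.lt_floor_add_one (x j * N / σ)
    unfold cellIndex at h1
    rw [abs_le] at h1 ⊢
    constructor <;> linarith
  have h3 : x i * N / σ - x j * N / σ = (N * (x i - x j)) / σ := by ring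
  rw [h3, abs_div, abs_of_pos hσ, div_le_iff₀ hσ, abs_mul, abs_of_nonneg (Nat.cast_nonneg N)] at h2
  exact h2

/-- The correlation of order `n + 2` is bounded below by pair counts inside disjoint sets of
indices; the power of the number of neighbours of a point is replaced by its tangent at `A l`. -/
lemma sum_tangent_le_boxCorrelation (n : ℕ) (x : ℕ → ℝ) {σ : ℝ} (hσ : 0 < σ) {N : ℕ}
    (hN : 0 < N) (q : ℕ) {ι : Type*} (S : Finset ι) (F : ι → Finset ℕ)
    (hF : ∀ l ∈ S, F l ⊆ Finset.Icc 1 N) (hdisj : (S : Set ι).PairwiseDisjoint F)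
    (A : ι → ℝ) (hA : ∀ l ∈ S, 0 ≤ A l) :
    ∑ l ∈ S, ((n + 1 : ℝ) * A l ^ n *
        (closePairs (cellIndex x σ N) (F l) q - (n + 1) * (F l).card) -
        n * A l ^ (n + 1) * (F l).card) ≤
      N * boxCorrelation (n + 2) x ((q + 1) * σ) N := by
  classical
  refine le_trans ?_ (sum_descFactorial_le_boxCorrelation (n + 1) x _ hN)
  have hsub : S.biUnion F ⊆ Finset.Icc 1 N := Finset.biUnion_subset.2 hF
  refine le_trans ?_ (Finset.sum_le_sum_of_subset_of_nonneg hsub fun _ _ _ => Nat.cast_nonneg _)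
  rw [Finset.sum_biUnion hdisj]
  refine Finset.sum_le_sum fun l hl => ?_
  have : (n + 1 : ℝ) * A l ^ n *
        (closePairs (cellIndex x σ N) (F l) q - (n + 1) * (F l).card) -
        n * A l ^ (n + 1) * (F l).card =
      ∑ i ∈ F l, ((n + 1 : ℝ) * A l ^ n * (((F l).filter fun j =>
        |cellIndex x σ N i - cellIndex x σ N j| ≤ q).card - (n + 1)) - n * A l ^ (n + 1)) := by
    rw [Finset.sum_sub_distrib, ← Finset.mul_sum, Finset.sum_sub_distrib]
    simp only [Finset.sum_const, nsmul_eq_mul, closePairs, Nat.cast_sum]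
    ring
  rw [this]
  exact Finset.sum_le_sum fun i _ => tangent_le_descFactorial n (hA l hl)
    (card_close_le_card_boxNeighbours x hσ N q (hF l hl) i)

/-! ### Empirical distribution functions -/

/-- The indices in `{1, …, N}` whose points lie in `(a, b]`. -/
noncomputable def indicesIoc (x : ℕ → ℝ) (N : ℕ) (a b : ℝ) : Finset ℕ :=
  open Classical in (Finset.Icc 1 N).filter fun i => x i ∈ Set.Ioc a b

lemma indicesIoc_subset (x : ℕ → ℝ) (N : ℕ) (a b : ℝ) : indicesIoc x N a b ⊆ Finset.Icc 1 N :=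
  Finset.filter_subset _ _

lemma mem_Ioc_of_mem_indicesIoc {x : ℕ → ℝ} {N : ℕ} {a b : ℝ} {i : ℕ}
    (hi : i ∈ indicesIoc x N a b) : x i ∈ Set.Ioc a b :=
  (Finset.mem_filter.1 hi).2

lemma disjoint_indicesIoc (x : ℕ → ℝ) (N : ℕ) {a b c d : ℝ}
    (h : Disjoint (Set.Ioc a b) (Set.Ioc c d)) :
    Disjoint (indicesIoc x N a b) (indicesIoc x N c d) :=
  Finset.disjoint_left.2 fun _ h1 h2 =>
    Set.disjoint_left.1 h (mem_Ioc_of_mem_indicesIoc h1) (mem_Ioc_of_mem_indicesIoc h2)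

lemma finite_setOf_le (x : ℕ → ℝ) (N : ℕ) (t : ℝ) :
    {n : ℕ | 1 ≤ n ∧ n ≤ N ∧ 0 ≤ x n ∧ x n ≤ t}.Finite :=
  (Set.finite_Icc 1 N).subset fun _ hn => ⟨hn.1, hn.2.1⟩

lemma card_indicesIoc_add_ncard (x : ℕ → ℝ) (N : ℕ) {a b : ℝ} (ha : 0 ≤ a) (hab : a ≤ b) :
    (indicesIoc x N a b).card + {n : ℕ | 1 ≤ n ∧ n ≤ N ∧ 0 ≤ x n ∧ x n ≤ a}.ncard =
      {n : ℕ | 1 ≤ n ∧ n ≤ N ∧ 0 ≤ x n ∧ x n ≤ b}.ncard := by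
  rw [← Set.ncard_coe_finset, ← Set.ncard_union_eq _ (Finset.finite_toSet _)
    (finite_setOf_le x N a)]
  · congr 1
    ext n
    simp only [indicesIoc, Finset.coe_filter, Finset.mem_Icc, Set.mem_Ioc, Set.mem_union,
      Set.mem_ofPred_eq]
    constructor
    · rintro (⟨⟨h1, h2⟩, h3, h4⟩ | ⟨h1, h2, h3, h4⟩)
      · exact ⟨h1, h2, by linarith, h4⟩
      · exact ⟨h1, h2, h3, by linarith⟩
    · rintro ⟨h1, h2, h3, h4⟩
      rcases le_or_gt (x n) a with h | h
      · exact Or.inr ⟨h1, h2, h3, h⟩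
      · exact Or.inl ⟨⟨h1, h2⟩, h, h4⟩
  · rw [Set.disjoint_left]
    intro n hn hn'
    exact absurd (mem_Ioc_of_mem_indicesIoc (Finset.mem_coe.1 hn)).1 (not_lt.2 hn'.2.2.2)

lemma tendsto_card_indicesIoc {x : ℕ → ℝ} {N : ℕ → ℕ} {G : ℝ → ℝ}
    (hG : IsAsymptoticDistributionAlong x N G) {a b : ℝ} (ha : 0 ≤ a) (hab : a ≤ b) (hb : b ≤ 1) :
    Tendsto (fun j => ((indicesIoc x (N j) a b).card : ℝ) / N j) atTop (nhds (G b - G a)) := by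
  refine ((hG.2 b ⟨ha.trans hab, hb⟩).sub (hG.2 a ⟨ha, hab.trans hb⟩)).congr fun j => ?_
  rw [← card_indicesIoc_add_ncard x (N j) ha hab]
  push_cast
  ring

lemma IsAsymptoticDistributionAlong.monotoneOn {x : ℕ → ℝ} {N : ℕ → ℕ} {G : ℝ → ℝ}
    (hG : IsAsymptoticDistributionAlong x N G) : MonotoneOn G (Set.Icc 0 1) := by
  intro a ha b hb hab
  have := ge_of_tendsto' (tendsto_card_indicesIoc hG ha.1 hab hb.2) (b := 0)
    fun j => by positivity
  linarith

/-! ### Divergence when the mass concentrates -/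

/-- If a fixed proportion of the points lies in finitely many intervals of arbitrarily small total
length, then the correlations diverge. -/
lemma tendsto_boxCorrelation_atTop (n : ℕ) (x : ℕ → ℝ) {N : ℕ → ℕ} (hN : StrictMono N) {ε : ℝ}
    (hε : 0 < ε) (h : ∀ δ : ℝ, 0 < δ → ∃ (m : ℕ) (a b : ℕ → ℝ) (F : ℕ → ℕ → Finset ℕ),
      (∀ l < m, a l ≤ b l) ∧ ∑ l ∈ Finset.range m, (b l - a l) ≤ δ ∧
      (∀ j, ∀ l < m, F j l ⊆ Finset.Icc 1 (N j) ∧ ∀ i ∈ F j l, x i ∈ Set.Icc (a l) (b l)) ∧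
      (∀ j, (Finset.range m : Set ℕ).PairwiseDisjoint (F j)) ∧
      ∀ᶠ j in atTop, ε * N j ≤ ∑ l ∈ Finset.range m, ((F j l).card : ℝ)) {s : ℝ} (hs : 0 < s) :
    Tendsto (fun j => boxCorrelation (n + 2) x s (N j)) atTop atTop := by
  rw [tendsto_atTop]
  intro C
  set D : ℝ := (n + 1) * (n + 1) + n with hD
  -- `B` is chosen so that the main term `(2 * B - D) * ε` exceeds `C` by at least `2`.
  set B : ℝ := (D + (|C| + 2) / ε) / 2 with hB
  have hBD : (2 * B - D) * ε = |C| + 2 := by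
    rw [hB]; field_simp; ring
  have hBD0 : 0 ≤ 2 * B - D := by
    have : 0 < |C| + 2 := by positivity
    by_contra! hneg
    nlinarith
  obtain ⟨m, a, b, F, hab, hlen, hF, hdisj, hcard⟩ := h (s / (B ^ 2 + 1)) (by positivity)
  have hNtop : Tendsto (fun j => (N j : ℝ)) atTop atTop :=
    tendsto_natCast_atTop_atTop.comp hN.tendsto_atTop
  filter_upwards [hcard, hNtop.eventually_ge_atTop (2 * m * B ^ 2),
    hNtop.eventually_gt_atTop 0] with j hj hNj hNpos
  have hNpos' : 0 < N j := by exact_mod_cast hNpos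
  have key := sum_tangent_le_boxCorrelation n x hs hNpos' 0 (Finset.range m) (F j)
    (fun l hl => (hF j l (Finset.mem_range.1 hl)).1) (hdisj j) (fun _ => 1)
    (fun _ _ => zero_le_one)
  have lower : ∑ l ∈ Finset.range m, ((2 * B - D) * ((F j l).card : ℝ) -
      B ^ 2 * ((b l - a l) * N j / s + 2)) ≤
      ∑ l ∈ Finset.range m, ((n + 1 : ℝ) * 1 ^ n *
        (closePairs (cellIndex x s (N j)) (F j l) 0 - (n + 1) * (F j l).card) -
        n * 1 ^ (n + 1) * (F j l).card) := by
    refine Finset.sum_le_sum fun l hl => ?_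
    have hl' := Finset.mem_range.1 hl
    have h1 := sum_closePairs_cellIndex_ge x hs (N j) (hab l hl') (F j l) (hF j l hl').2 1 B
    simp only [Finset.range_one, Finset.sum_singleton, Nat.cast_one, mul_one] at h1
    have h2 : (0 : ℝ) ≤ n * (closePairs (cellIndex x s (N j)) (F j l) 0 : ℝ) := by positivity
    simp only [one_pow, mul_one]
    rw [hD]
    nlinarith
  have upper := lower.trans key
  rw [Finset.sum_sub_distrib, ← Finset.mul_sum, ← Finset.mul_sum, Finset.sum_add_distrib,
    ← Finset.sum_div, ← Finset.sum_mul, Finset.sum_const, Finset.card_range, nsmul_eq_mul] at upper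
  simp only [Nat.cast_zero, zero_add, one_mul] at upper
  have h1 : (2 * B - D) * (ε * N j) ≤
      (2 * B - D) * ∑ l ∈ Finset.range m, ((F j l).card : ℝ) := by gcongr
  have h2 : B ^ 2 * ((∑ l ∈ Finset.range m, (b l - a l)) * N j / s) ≤ N j := by
    calc B ^ 2 * ((∑ l ∈ Finset.range m, (b l - a l)) * N j / s)
        ≤ B ^ 2 * (s / (B ^ 2 + 1) * N j / s) := by gcongr
      _ = (B ^ 2 / (B ^ 2 + 1)) * N j := by field_simp
      _ ≤ 1 * N j := by
        gcongr
        rw [div_le_one (by positivity)]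
        linarith
      _ = N j := one_mul _
  have h3 : |C| * N j ≤ N j * boxCorrelation (n + 2) x s (N j) := by
    have : (2 * B - D) * (ε * N j) = (|C| + 2) * N j := by rw [← hBD]; ring
    nlinarith
  have h4 : |C| ≤ boxCorrelation (n + 2) x s (N j) := by
    rw [mul_comm] at h3
    exact le_of_mul_le_mul_left h3 hNpos
  exact (le_abs_self C).trans h4

lemma tendsto_boxCorrelation_of_not_absolutelyContinuous (n : ℕ) {x : ℕ → ℝ} {N : ℕ → ℕ}
    {G : ℝ → ℝ} (hG : IsAsymptoticDistributionAlong x N G)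
    (hac : ¬ AbsolutelyContinuousOnInterval G 0 1) {s : ℝ} (hs : 0 < s) :
    Tendsto (fun j => boxCorrelation (n + 2) x s (N j)) atTop atTop := by
  rw [absolutelyContinuousOnInterval_iff] at hac
  push Not at hac
  obtain ⟨ε, hε, H⟩ := hac
  refine tendsto_boxCorrelation_atTop n x hG.1 (half_pos hε) (fun δ hδ => ?_) hs
  obtain ⟨⟨m, I⟩, ⟨hmem, hdisj⟩, hlen, hsum⟩ := H δ hδ
  simp only [Set.uIcc_of_le (zero_le_one' ℝ), Finset.mem_range] at hmem hdisj hlen hsum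
  set a : ℕ → ℝ := fun l => min (I l).1 (I l).2 with ha
  set b : ℕ → ℝ := fun l => max (I l).1 (I l).2 with hb
  have hab : ∀ l, a l ≤ b l := fun l => min_le_max
  have ha0 : ∀ l < m, 0 ≤ a l := fun l hl => le_min (hmem l hl).1.1 (hmem l hl).2.1
  have hb1 : ∀ l < m, b l ≤ 1 := fun l hl => max_le (hmem l hl).1.2 (hmem l hl).2.2
  have hdist : ∀ l < m, dist (G (I l).1) (G (I l).2) = G (b l) - G (a l) := by
    intro l hl
    have hm := hG.monotoneOn
    rw [Real.dist_eq]
    simp only [ha, hb]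
    rcases le_total (I l).1 (I l).2 with h | h
    · rw [min_eq_left h, max_eq_right h, abs_sub_comm, abs_of_nonneg]
      exact sub_nonneg.2 (hm (hmem l hl).1 (hmem l hl).2 h)
    · rw [min_eq_right h, max_eq_left h, abs_of_nonneg]
      exact sub_nonneg.2 (hm (hmem l hl).2 (hmem l hl).1 h)
  refine ⟨m, a, b, fun j l => indicesIoc x (N j) (a l) (b l), fun l _ => hab l, ?_, ?_, ?_, ?_⟩
  · refine le_trans (le_of_eq (Finset.sum_congr rfl fun l _ => ?_)) hlen.le
    rw [Real.dist_eq, ← max_sub_min_eq_abs']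
  · intro j l _
    exact ⟨indicesIoc_subset _ _ _ _, fun i hi =>
      Set.Ioc_subset_Icc_self (mem_Ioc_of_mem_indicesIoc hi)⟩
  · intro j l hl l' hl' hne
    exact disjoint_indicesIoc x (N j) (hdisj hl hl' hne)
  · have hlim : Tendsto (fun j => ∑ l ∈ Finset.range m,
        ((indicesIoc x (N j) (a l) (b l)).card : ℝ) / N j) atTop
        (nhds (∑ l ∈ Finset.range m, (G (b l) - G (a l)))) :=
      tendsto_finsetSum _ fun l hl => tendsto_card_indicesIoc hG (ha0 l (Finset.mem_range.1 hl))
        (hab l) (hb1 l (Finset.mem_range.1 hl))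
    have hbig : ε / 2 < ∑ l ∈ Finset.range m, (G (b l) - G (a l)) := by
      rw [← Finset.sum_congr rfl fun l hl => hdist l (Finset.mem_range.1 hl)]
      linarith
    filter_upwards [hlim.eventually (lt_mem_nhds hbig), hG.1.tendsto_atTop.eventually_gt_atTop 0]
      with j hj hNj
    have hNj' : (0 : ℝ) < N j := by exact_mod_cast hNj
    rw [← Finset.sum_div, lt_div_iff₀ hNj'] at hj
    exact hj.le

lemma tendsto_boxCorrelation_of_pos_zero (n : ℕ) {x : ℕ → ℝ} {N : ℕ → ℕ} {G : ℝ → ℝ}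
    (hG : IsAsymptoticDistributionAlong x N G) (h0 : 0 < G 0) {s : ℝ} (hs : 0 < s) :
    Tendsto (fun j => boxCorrelation (n + 2) x s (N j)) atTop atTop := by
  refine tendsto_boxCorrelation_atTop n x hG.1 (half_pos h0) (fun δ hδ => ?_) hs
  refine ⟨1, fun _ => 0, fun _ => 0, fun j _ => (finite_setOf_le x (N j) 0).toFinset,
    fun _ _ => le_rfl, by simpa using hδ.le, ?_, ?_, ?_⟩
  · intro j l _
    refine ⟨fun i hi => ?_, fun i hi => ?_⟩ <;> rw [Set.Finite.mem_toFinset] at hi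
    · exact Finset.mem_Icc.2 ⟨hi.1, hi.2.1⟩
    · exact hi.2.2
  · intro j l hl l' hl' hne
    simp only [Finset.coe_range, Set.mem_Iio] at hl hl'
    omega
  · have hlim := hG.2 0 ⟨le_rfl, zero_le_one⟩
    filter_upwards [hlim.eventually (lt_mem_nhds (half_lt_self h0)),
      hG.1.tendsto_atTop.eventually_gt_atTop 0] with j hj hNj
    have hNj' : (0 : ℝ) < N j := by exact_mod_cast hNj
    rw [lt_div_iff₀ hNj'] at hj
    simpa [← Set.ncard_eq_toFinset_card _ (finite_setOf_le x (N j) 0)] using hj.le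

/-! ### The lower bound for averages over a partition -/

/-- Pair counts for one scale `q + 1`: with tangent points proportional to the scale, the factor
`(2 * (q + 1)) ^ n` splits off, and dividing by it leaves an expression linear in the scale. -/
lemma sum_scaled_tangent_le (n : ℕ) (x : ℕ → ℝ) {N : ℕ} (hN : 0 < N) (q : ℕ) {ι : Type*}
    (S : Finset ι) (F : ι → Finset ℕ) (hF : ∀ l ∈ S, F l ⊆ Finset.Icc 1 N)
    (hdisj : (S : Set ι).PairwiseDisjoint F) (a : ι → ℝ) (ha : ∀ l ∈ S, 0 ≤ a l) {R : ℝ}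
    (hR : boxCorrelation (n + 2) x (q + 1) N ≤ (2 * (q + 1 : ℝ)) ^ n * R) :
    ∑ l ∈ S, ((n + 1 : ℝ) * a l ^ n *
        (closePairs (cellIndex x 1 N) (F l) q - (n + 1) * (F l).card) -
        n * a l ^ (n + 1) * (2 * (q + 1)) * (F l).card) ≤ N * R := by
  have hw : (0 : ℝ) < 2 * (q + 1) := by positivity
  have key := sum_tangent_le_boxCorrelation n x one_pos hN q S F hF hdisj
    (fun l => a l * (2 * (q + 1))) fun l hl => mul_nonneg (ha l hl) hw.le
  rw [mul_one] at key
  have h2 := key.trans (mul_le_mul_of_nonneg_left hR (Nat.cast_nonneg N))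
  refine le_of_mul_le_mul_left ?_ (pow_pos hw n)
  refine le_trans (le_of_eq ?_) (h2.trans (le_of_eq (by ring)))
  rw [Finset.mul_sum]
  refine Finset.sum_congr rfl fun l _ => ?_
  rw [mul_pow (a l), mul_pow (a l), pow_succ (2 * (q + 1 : ℝ)) n]
  generalize (2 * (q + 1 : ℝ)) ^ n = w
  ring

/-- Summation of the pair counts over the scales `1, …, Q`. -/
lemma sum_window_tangent_le (n : ℕ) (x : ℕ → ℝ) {N : ℕ} (hN : 0 < N) (Q : ℕ) {ι : Type*}
    (S : Finset ι) (F : ι → Finset ℕ) (hF : ∀ l ∈ S, F l ⊆ Finset.Icc 1 N)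
    (hdisj : (S : Set ι).PairwiseDisjoint F) (u v : ι → ℝ) (huv : ∀ l ∈ S, u l ≤ v l)
    (hx : ∀ l ∈ S, ∀ i ∈ F l, x i ∈ Set.Icc (u l) (v l))
    (a : ι → ℝ) (ha : ∀ l ∈ S, 0 ≤ a l) (R : ℕ → ℝ)
    (hR : ∀ q ∈ Finset.range Q,
      boxCorrelation (n + 2) x (q + 1) N ≤ (2 * (q + 1 : ℝ)) ^ n * R q) :
    ∑ l ∈ S, ((n + 1 : ℝ) * a l ^ n * (2 * a l * Q ^ 2 * (F l).card -
        a l ^ 2 * Q ^ 2 * ((v l - u l) * N + Q + 1) - (n + 1) * Q * (F l).card) -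
        n * a l ^ (n + 1) * (Q * (Q + 1)) * (F l).card) ≤ N * ∑ q ∈ Finset.range Q, R q := by
  have key := Finset.sum_le_sum fun q hq =>
    sum_scaled_tangent_le n x hN q S F hF hdisj a ha (hR q hq)
  rw [← Finset.mul_sum] at key
  refine le_trans ?_ key
  rw [Finset.sum_comm]
  refine Finset.sum_le_sum fun l hl => ?_
  -- A window of `Q` cells of density `a l` is expected to contain `a l * Q` points.
  have h1 := sum_closePairs_cellIndex_ge x one_pos N (huv l hl) (F l) (hx l hl) Q (a l * Q)
  have h2 : ∀ Q : ℕ, ∑ q ∈ Finset.range Q, ((n + 1 : ℝ) * a l ^ n *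
        (closePairs (cellIndex x 1 N) (F l) q - (n + 1) * (F l).card) -
        n * a l ^ (n + 1) * (2 * (q + 1)) * (F l).card) =
      (n + 1 : ℝ) * a l ^ n * (∑ q ∈ Finset.range Q, (closePairs (cellIndex x 1 N) (F l) q : ℝ) -
        (n + 1) * Q * (F l).card) - n * a l ^ (n + 1) * (Q * (Q + 1)) * (F l).card := by
    intro Q
    induction Q with
    | zero => simp
    | succ Q ih =>
      rw [Finset.sum_range_succ, ih, Finset.sum_range_succ]
      push_cast
      ring
  rw [h2]
  have h3 : (0 : ℝ) ≤ (n + 1 : ℝ) * a l ^ n := by have := ha l hl; positivity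
  have h4 := mul_le_mul_of_nonneg_left h1 h3
  rw [div_one] at h4
  nlinarith

/-- Letting the number of points tend to infinity with the scales `1, …, Q` fixed. -/
lemma sum_limit_tangent_le (n : ℕ) {x : ℕ → ℝ} {N : ℕ → ℕ} {G : ℝ → ℝ}
    (hG : IsAsymptoticDistributionAlong x N G) (Q : ℕ) {ι : Type*} (S : Finset ι) (u v : ι → ℝ)
    (hu : ∀ l ∈ S, 0 ≤ u l) (huv : ∀ l ∈ S, u l ≤ v l) (hv : ∀ l ∈ S, v l ≤ 1)
    (hdisj : (S : Set ι).PairwiseDisjoint fun l => Set.Ioc (u l) (v l))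
    (a : ι → ℝ) (ha : ∀ l ∈ S, 0 ≤ a l) (R : ℕ → ℝ)
    (hR : ∀ q ∈ Finset.range Q, ∀ᶠ j in atTop,
      boxCorrelation (n + 2) x (q + 1) (N j) ≤ (2 * (q + 1 : ℝ)) ^ n * R q) :
    ∑ l ∈ S, ((n + 1 : ℝ) * a l ^ n * (2 * a l * Q ^ 2 * (G (v l) - G (u l)) -
        a l ^ 2 * Q ^ 2 * (v l - u l) - (n + 1) * Q * (G (v l) - G (u l))) -
        n * a l ^ (n + 1) * (Q * (Q + 1)) * (G (v l) - G (u l))) ≤ ∑ q ∈ Finset.range Q, R q := by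
  have hinv : Tendsto (fun j => (1 : ℝ) / N j) atTop (nhds 0) :=
    tendsto_one_div_atTop_nhds_zero_nat.comp hG.1.tendsto_atTop
  have hlim : Tendsto (fun j => ∑ l ∈ S, ((n + 1 : ℝ) * a l ^ n *
        (2 * a l * Q ^ 2 * (((indicesIoc x (N j) (u l) (v l)).card : ℝ) / N j) -
        a l ^ 2 * Q ^ 2 * ((v l - u l) + (Q + 1) * (1 / N j)) -
        (n + 1) * Q * (((indicesIoc x (N j) (u l) (v l)).card : ℝ) / N j)) -
        n * a l ^ (n + 1) * (Q * (Q + 1)) *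
          (((indicesIoc x (N j) (u l) (v l)).card : ℝ) / N j))) atTop
      (nhds (∑ l ∈ S, ((n + 1 : ℝ) * a l ^ n * (2 * a l * Q ^ 2 * (G (v l) - G (u l)) -
        a l ^ 2 * Q ^ 2 * ((v l - u l) + (Q + 1) * 0) - (n + 1) * Q * (G (v l) - G (u l))) -
        n * a l ^ (n + 1) * (Q * (Q + 1)) * (G (v l) - G (u l))))) := by
    refine tendsto_finsetSum _ fun l hl => ?_
    have hc := tendsto_card_indicesIoc hG (hu l hl) (huv l hl) (hv l hl)
    have hcont : Continuous fun p : ℝ × ℝ => (n + 1 : ℝ) * a l ^ n *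
        (2 * a l * Q ^ 2 * p.1 - a l ^ 2 * Q ^ 2 * ((v l - u l) + (Q + 1) * p.2) -
        (n + 1) * Q * p.1) - n * a l ^ (n + 1) * (Q * (Q + 1)) * p.1 := by fun_prop
    have hlim := (hcont.tendsto (G (v l) - G (u l), 0)).comp (hc.prodMk_nhds hinv)
    simpa only [Function.comp_def] using hlim
  simp only [mul_zero, add_zero] at hlim
  refine le_of_tendsto hlim ?_
  filter_upwards [(Finset.eventually_all (Finset.range Q)).2 hR,
    hG.1.tendsto_atTop.eventually_gt_atTop 0] with j hj hNj
  have hNj' : (0 : ℝ) < N j := by exact_mod_cast hNj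
  have key := sum_window_tangent_le n x hNj Q S (fun l => indicesIoc x (N j) (u l) (v l))
    (fun l _ => indicesIoc_subset _ _ _ _)
    (fun l hl l' hl' hne => disjoint_indicesIoc x (N j) (hdisj hl hl' hne)) u v huv
    (fun l _ i hi => Set.Ioc_subset_Icc_self (mem_Ioc_of_mem_indicesIoc hi)) a ha R hj
  refine le_of_mul_le_mul_left (le_trans (le_of_eq ?_) key) hNj'
  rw [Finset.mul_sum]
  refine Finset.sum_congr rfl fun l _ => ?_
  field_simp
  ring

/-- If the correlations at all large scales `s` are at most `c * (2 * s) ^ (n + 1)`, then so are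
the `(n + 2)`-nd moments of the difference quotients of `G` over finitely many disjoint
intervals. -/
theorem sum_moment_le_of_boxCorrelation_le (n : ℕ) {x : ℕ → ℝ} {N : ℕ → ℕ} {G : ℝ → ℝ}
    (hG : IsAsymptoticDistributionAlong x N G) {c s₀ : ℝ} (hc : 0 ≤ c)
    (hR : ∀ s, s₀ ≤ s → ∀ᶠ j in atTop,
      boxCorrelation (n + 2) x s (N j) ≤ c * (2 * s) ^ (n + 1))
    {ι : Type*} (S : Finset ι) (u v : ι → ℝ)
    (hu : ∀ l ∈ S, 0 ≤ u l) (huv : ∀ l ∈ S, u l < v l) (hv : ∀ l ∈ S, v l ≤ 1)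
    (hdisj : (S : Set ι).PairwiseDisjoint fun l => Set.Ioc (u l) (v l)) :
    ∑ l ∈ S, (v l - u l) * ((G (v l) - G (u l)) / (v l - u l)) ^ (n + 2) ≤ c := by
  obtain ⟨q₀, hq₀⟩ := exists_nat_ge (max s₀ 0)
  have hq₀' : s₀ ≤ q₀ := (le_max_left _ _).trans hq₀
  set E : ℝ := c * (2 * q₀) ^ (n + 1) with hE
  have hE0 : 0 ≤ E := by positivity
  set R : ℕ → ℝ := fun q => c * (2 * (q + 1)) + if q < q₀ then E else 0 with hRdef
  -- Below the scale `q₀` nothing is assumed, but the correlation is monotone in the scale.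
  have hRq : ∀ q : ℕ, ∀ᶠ j in atTop,
      boxCorrelation (n + 2) x (q + 1) (N j) ≤ (2 * (q + 1 : ℝ)) ^ n * R q := by
    intro q
    by_cases hq : q < q₀
    · filter_upwards [hR q₀ hq₀'] with j hj
      have hle : (q + 1 : ℝ) ≤ q₀ := by exact_mod_cast hq
      refine (boxCorrelation_mono (n + 1) x (N j) hle).trans (hj.trans ?_)
      have h1 : (1 : ℝ) ≤ (2 * (q + 1 : ℝ)) ^ n := one_le_pow₀ (by
        have : (0 : ℝ) ≤ q := Nat.cast_nonneg q
        linarith)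
      have h2 : E ≤ R q := by
        simp only [hRdef, if_pos hq]
        have : 0 ≤ c * (2 * ((q : ℝ) + 1)) := by positivity
        linarith
      calc E ≤ 1 * R q := by rw [one_mul]; exact h2
        _ ≤ (2 * (q + 1 : ℝ)) ^ n * R q := by
          gcongr
    · filter_upwards [hR (q + 1) (hq₀'.trans (by
        have : (q₀ : ℝ) ≤ q := by exact_mod_cast not_lt.1 hq
        linarith))] with j hj
      refine hj.trans (le_of_eq ?_)
      simp only [hRdef, if_neg hq]
      ring
  have hsumR : ∀ Q : ℕ, ∑ q ∈ Finset.range Q, R q ≤ c * (Q * (Q + 1)) + q₀ * E := by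
    intro Q
    simp only [hRdef]
    rw [Finset.sum_add_distrib]
    have h1 : ∑ q ∈ Finset.range Q, c * (2 * ((q : ℝ) + 1)) = c * (Q * (Q + 1)) := by
      induction Q with
      | zero => simp
      | succ Q ih =>
        rw [Finset.sum_range_succ, ih]
        push_cast
        ring
    have h2 : ∑ q ∈ Finset.range Q, (if q < q₀ then E else 0) ≤ q₀ * E := by
      rw [← Finset.sum_filter, Finset.sum_const, nsmul_eq_mul]
      gcongr
      refine (Finset.card_le_card (t := Finset.range q₀) fun q hq => ?_).trans
        (Finset.card_range q₀).le
      exact Finset.mem_range.2 (Finset.mem_filter.1 hq).2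
    linarith
  -- The mean density is the optimal tangent point.
  set a : ι → ℝ := fun l => (G (v l) - G (u l)) / (v l - u l) with ha_def
  have ha : ∀ l ∈ S, 0 ≤ a l := fun l hl =>
    div_nonneg (sub_nonneg.2 (hG.monotoneOn ⟨hu l hl, (huv l hl).le.trans (hv l hl)⟩
      ⟨(hu l hl).trans (huv l hl).le, hv l hl⟩ (huv l hl).le)) (sub_nonneg.2 (huv l hl).le)
  have hGa : ∀ l ∈ S, G (v l) - G (u l) = a l * (v l - u l) := fun l hl => by
    rw [ha_def, div_mul_cancel₀ _ (sub_pos.2 (huv l hl)).ne']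
  have hQinv : Tendsto (fun Q : ℕ => (1 : ℝ) / Q) atTop (nhds 0) :=
    tendsto_one_div_atTop_nhds_zero_nat
  have hleft : Tendsto (fun Q : ℕ => ∑ l ∈ S, ((n + 1 : ℝ) * a l ^ n *
      (2 * a l * (a l * (v l - u l)) - a l ^ 2 * (v l - u l) -
        (n + 1) * (1 / Q) * (a l * (v l - u l))) -
      n * a l ^ (n + 1) * (1 + 1 / Q) * (a l * (v l - u l)))) atTop
      (nhds (∑ l ∈ S, ((n + 1 : ℝ) * a l ^ n *
      (2 * a l * (a l * (v l - u l)) - a l ^ 2 * (v l - u l) -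
        (n + 1) * 0 * (a l * (v l - u l))) -
      n * a l ^ (n + 1) * (1 + 0) * (a l * (v l - u l))))) := by
    refine tendsto_finsetSum _ fun l _ => ?_
    have hcont : Continuous fun p : ℝ => (n + 1 : ℝ) * a l ^ n *
      (2 * a l * (a l * (v l - u l)) - a l ^ 2 * (v l - u l) -
        (n + 1) * p * (a l * (v l - u l))) -
      n * a l ^ (n + 1) * (1 + p) * (a l * (v l - u l)) := by fun_prop
    have hlim := (hcont.tendsto 0).comp hQinv
    simpa only [Function.comp_def] using hlim
  have hright : Tendsto (fun Q : ℕ => c * (1 + 1 / Q) + q₀ * E * (1 / Q) * (1 / Q)) atTop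
      (nhds (c * (1 + 0) + q₀ * E * 0 * 0)) :=
    ((hQinv.const_add 1).const_mul c).add ((hQinv.const_mul _).mul hQinv)
  have hmain := le_of_tendsto_of_tendsto hleft hright ?_
  · refine le_trans (le_of_eq ?_) (hmain.trans (by simp))
    refine Finset.sum_congr rfl fun l _ => ?_
    simp only [ha_def]
    ring
  filter_upwards [eventually_gt_atTop 0] with Q hQ
  have hQ' : (0 : ℝ) < Q := by exact_mod_cast hQ
  have key := (sum_limit_tangent_le n hG Q S u v hu (fun l hl => (huv l hl).le) hv hdisj a ha R
    fun q _ => hRq q).trans (hsumR Q)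
  refine le_of_mul_le_mul_left ?_ (pow_pos hQ' 2)
  refine le_trans (le_of_eq ?_) (key.trans (le_of_eq ?_))
  · rw [Finset.mul_sum]
    refine Finset.sum_congr rfl fun l hl => ?_
    rw [hGa l hl]
    field_simp
  · field_simp

/-! ### Densities -/

lemma exists_isDensityOf {G : ℝ → ℝ} (hmono : MonotoneOn G (Set.Icc 0 1))
    (hac : AbsolutelyContinuousOnInterval G 0 1) : ∃ g : ℝ → ℝ, IsDensityOf g G := by
  refine ⟨deriv G, ?_, ?_, ?_⟩
  · exact (intervalIntegrable_iff_integrableOn_Icc_of_le zero_le_one).1 hac.intervalIntegrable_deriv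
  · rw [← restrict_Ioo_eq_restrict_Icc]
    filter_upwards [ae_restrict_mem measurableSet_Ioo] with t ht
    rw [← derivWithin_of_isOpen isOpen_Ioo ht]
    exact (hmono.mono Set.Ioo_subset_Icc_self).derivWithin_nonneg
  · intro a b ha hab hb
    rw [← intervalIntegral.integral_of_le hab]
    refine (hac.mono ?_).integral_deriv_eq_sub
    rw [Set.uIcc_of_le hab, Set.uIcc_of_le zero_le_one]
    exact Set.Icc_subset_Icc ha hb

/-- The difference quotient of `G` over the interval `(l / m, (l + 1) / m]`. -/
noncomputable def stepSlope (G : ℝ → ℝ) (m l : ℕ) : ℝ :=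
  m * (G ((l + 1) / m) - G (l / m))

/-- The step function equal to `stepSlope G m l` on `(l / m, (l + 1) / m]`. -/
noncomputable def stepDensity (G : ℝ → ℝ) (m : ℕ) (t : ℝ) : ℝ :=
  stepSlope G m (⌈t * m⌉₊ - 1)

lemma measurable_stepDensity (G : ℝ → ℝ) (m : ℕ) : Measurable (stepDensity G m) :=
  (measurable_from_nat (f := fun l => stepSlope G m (l - 1))).comp
    (Nat.measurable_ceil.comp (measurable_id.mul_const _))

/-- The cell `(l / m, (l + 1) / m]` has index `⌈t * m⌉₊ - 1` for each of its points `t`. -/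
lemma ceil_mul_sub_one_of_mem_Ioc {m : ℕ} (hm : 0 < m) {l : ℕ} {t : ℝ}
    (ht : t ∈ Set.Ioc ((l : ℝ) / m) ((l + 1) / m)) : ⌈t * m⌉₊ - 1 = l := by
  have hm' : (0 : ℝ) < m := by exact_mod_cast hm
  have h1 := (div_lt_iff₀ hm').1 ht.1
  have h2 := (le_div_iff₀ hm').1 ht.2
  have : ⌈t * m⌉₊ = l + 1 := by
    rw [Nat.ceil_eq_iff (Nat.succ_ne_zero l)]
    simpa using ⟨h1, h2⟩
  omega

lemma mem_Ioc_ceil_mul_sub_one {m : ℕ} (hm : 0 < m) {t : ℝ} (ht : t ∈ Set.Ioc (0 : ℝ) 1) :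
    ⌈t * m⌉₊ - 1 < m ∧
      t ∈ Set.Ioc (((⌈t * m⌉₊ - 1 : ℕ) : ℝ) / m) (((⌈t * m⌉₊ - 1 : ℕ) + 1) / m) := by
  have hm' : (0 : ℝ) < m := by exact_mod_cast hm
  have hpos : 0 < ⌈t * m⌉₊ := Nat.ceil_pos.2 (mul_pos ht.1 hm')
  have hle : ⌈t * m⌉₊ ≤ m := Nat.ceil_le.2 (by nlinarith [ht.2])
  have h1 := Nat.le_ceil (t * m)
  have h2 := Nat.ceil_lt_add_one (mul_pos ht.1 hm').le
  have hcast : ((⌈t * m⌉₊ - 1 : ℕ) : ℝ) = ⌈t * m⌉₊ - 1 := by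
    rw [Nat.cast_sub hpos, Nat.cast_one]
  refine ⟨by omega, ?_, ?_⟩
  · rw [div_lt_iff₀ hm', hcast]; linarith
  · rw [le_div_iff₀ hm', hcast]; linarith

lemma pairwiseDisjoint_Ioc_div {m : ℕ} (hm : 0 < m) (s : Set ℕ) :
    s.PairwiseDisjoint fun l : ℕ => Set.Ioc ((l : ℝ) / m) ((l + 1) / m) :=
  fun _ _ _ _ hne => Set.disjoint_left.2 fun _ h1 h2 => hne
    ((ceil_mul_sub_one_of_mem_Ioc hm h1).symm.trans (ceil_mul_sub_one_of_mem_Ioc hm h2))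

lemma lintegral_stepDensity_pow (G : ℝ → ℝ) {m : ℕ} (hm : 0 < m) (k : ℕ) :
    ∫⁻ t in Set.Ioc (0 : ℝ) 1, ENNReal.ofReal (stepDensity G m t) ^ k =
      ∑ l ∈ Finset.range m, ENNReal.ofReal (stepSlope G m l) ^ k * ENNReal.ofReal (1 / m) := by
  have hm' : (0 : ℝ) < m := by exact_mod_cast hm
  have hunion : Set.Ioc (0 : ℝ) 1 =
      ⋃ l ∈ Finset.range m, Set.Ioc ((l : ℝ) / m) ((l + 1) / m) := by
    ext t
    simp only [Set.mem_iUnion, Finset.mem_range, exists_prop]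
    constructor
    · intro ht
      exact ⟨_, mem_Ioc_ceil_mul_sub_one hm ht⟩
    · rintro ⟨l, hl, h1, h2⟩
      refine ⟨lt_of_le_of_lt (by positivity) h1, h2.trans ?_⟩
      rw [div_le_one hm']
      exact_mod_cast hl
  rw [hunion, lintegral_biUnion_finset (pairwiseDisjoint_Ioc_div hm _)
    (fun _ _ => measurableSet_Ioc)]
  refine Finset.sum_congr rfl fun l _ => ?_
  rw [setLIntegral_congr_fun (g := fun _ => ENNReal.ofReal (stepSlope G m l) ^ k)
    measurableSet_Ioc fun t ht => ?_]
  · rw [setLIntegral_const, Real.volume_Ioc]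
    congr 2
    field_simp
    ring
  · simp only [stepDensity, ceil_mul_sub_one_of_mem_Ioc hm ht]

/-- Lebesgue's differentiation theorem along the partitions of `[0, 1]` into equal intervals. -/
lemma IsDensityOf.ae_tendsto_stepDensity {g G : ℝ → ℝ} (hg : IsDensityOf g G) :
    ∀ᵐ t ∂(volume.restrict (Set.Ioc (0 : ℝ) 1)),
      Tendsto (fun m : ℕ => stepDensity G m t) atTop (nhds (g t)) := by
  have hloc : LocallyIntegrable ((Set.Icc (0 : ℝ) 1).indicator g) volume :=
    ((integrable_indicator_iff measurableSet_Icc).2 hg.integrableOn).locallyIntegrable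
  rw [ae_restrict_iff' measurableSet_Ioc]
  filter_upwards [IsUnifLocDoublingMeasure.ae_tendsto_average (μ := volume) hloc 1] with t ht htI
  have hδ : Tendsto (fun m : ℕ => 1 / 2 * (1 / (m : ℝ))) atTop (nhdsWithin 0 (Set.Ioi 0)) := by
    refine tendsto_nhdsWithin_iff.2 ⟨?_, ?_⟩
    · simpa using tendsto_one_div_atTop_nhds_zero_nat.const_mul (1 / 2 : ℝ)
    · filter_upwards [eventually_gt_atTop 0] with m hm
      have : (0 : ℝ) < m := by exact_mod_cast hm
      exact Set.mem_Ioi.2 (by positivity)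
  -- The cells of the partition are closed balls, up to an endpoint.
  have hball : ∀ l m : ℕ, Metric.closedBall (((l : ℝ) + 1 / 2) / m) (1 / 2 * (1 / (m : ℝ))) =
      Set.Icc ((l : ℝ) / m) ((l + 1) / m) := by
    intro l m
    rw [Real.closedBall_eq_Icc]
    congr 1 <;> ring
  have hmem : ∀ᶠ m : ℕ in atTop, t ∈ Metric.closedBall
      ((((⌈t * m⌉₊ - 1 : ℕ) : ℝ) + 1 / 2) / m) (1 * (1 / 2 * (1 / (m : ℝ)))) := by
    filter_upwards [eventually_gt_atTop 0] with m hm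
    rw [one_mul, hball]
    exact Set.Ioc_subset_Icc_self (mem_Ioc_ceil_mul_sub_one hm htI).2
  have hlim := ht (fun m : ℕ => (((⌈t * m⌉₊ - 1 : ℕ) : ℝ) + 1 / 2) / m) _ hδ hmem
  rw [Set.indicator_of_mem (Set.Ioc_subset_Icc_self htI)] at hlim
  refine hlim.congr' ?_
  filter_upwards [eventually_gt_atTop 0] with m hm
  have hm' : (0 : ℝ) < m := by exact_mod_cast hm
  obtain ⟨hlt, -⟩ := mem_Ioc_ceil_mul_sub_one hm htI
  unfold stepDensity
  generalize ⌈t * m⌉₊ - 1 = l at hlt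
  have hle : (l : ℝ) / m ≤ (l + 1) / m := by gcongr; linarith
  have h0 : 0 ≤ (l : ℝ) / m := by positivity
  have h1 : ((l : ℝ) + 1) / m ≤ 1 := by
    rw [div_le_one hm']
    exact_mod_cast hlt
  rw [hball, setAverage_eq, Real.volume_real_Icc_of_le hle,
    setIntegral_indicator measurableSet_Icc,
    Set.inter_eq_left.2 (Set.Icc_subset_Icc h0 h1), integral_Icc_eq_integral_Ioc,
    hg.integral_eq _ _ h0 hle h1, stepSlope, smul_eq_mul]
  congr 1
  field_simp
  ring

/-- A bound for the moments of the difference quotients over all equal partitions passes to the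
density by Fatou's lemma. -/
lemma IsDensityOf.lintegral_pow_le {g G : ℝ → ℝ} (hg : IsDensityOf g G) (k : ℕ) {c : ℝ}
    (hpos : ∀ m l : ℕ, l < m → 0 ≤ stepSlope G m l)
    (h : ∀ m : ℕ, 0 < m → ∑ l ∈ Finset.range m, 1 / (m : ℝ) * stepSlope G m l ^ k ≤ c) :
    ∫⁻ t in Set.Icc (0 : ℝ) 1, ENNReal.ofReal (g t) ^ k ≤ ENNReal.ofReal c := by
  rw [← restrict_Ioc_eq_restrict_Icc]
  have hle : ∫⁻ t in Set.Ioc (0 : ℝ) 1, ENNReal.ofReal (g t) ^ k ≤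
      ∫⁻ t in Set.Ioc (0 : ℝ) 1,
        liminf (fun m : ℕ => ENNReal.ofReal (stepDensity G m t) ^ k) atTop := by
    refine lintegral_mono_ae ?_
    filter_upwards [hg.ae_tendsto_stepDensity] with t ht
    exact (((ENNReal.continuous_pow k).tendsto _).comp
      ((ENNReal.continuous_ofReal.tendsto _).comp ht)).liminf_eq.ge
  refine hle.trans ((lintegral_liminf_le fun m =>
    (measurable_stepDensity G m).ennreal_ofReal.pow_const k).trans ?_)
  refine liminf_le_of_frequently_le' (Eventually.frequently ?_)
  filter_upwards [eventually_gt_atTop 0] with m hm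
  rw [lintegral_stepDensity_pow G hm]
  refine le_trans (le_of_eq ?_) (ENNReal.ofReal_le_ofReal (h m hm))
  rw [ENNReal.ofReal_sum_of_nonneg fun l hl => mul_nonneg (by positivity)
    (pow_nonneg (hpos m l (Finset.mem_range.1 hl)) k)]
  refine Finset.sum_congr rfl fun l hl => ?_
  rw [ENNReal.ofReal_mul (by positivity), ENNReal.ofReal_pow (hpos m l (Finset.mem_range.1 hl)),
    mul_comm]

/-! ### Divergence and lower bound for the correlations -/

theorem theorem1p2 (k : ℕ) (hk : 2 ≤ k)
    (x : ℕ → ℝ) (hx : ∀ n, 1 ≤ n → x n ∈ Set.Icc (0 : ℝ) 1)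
    (G : ℝ → ℝ) (N : ℕ → ℕ) (hG : IsAsymptoticDistributionAlong x N G) :
    ((¬ AbsolutelyContinuousOnInterval G 0 1 ∨ 0 < G 0) →
      ∀ s : ℝ, 0 < s → Tendsto (fun j => boxCorrelation k x s (N j)) atTop atTop) ∧
    (AbsolutelyContinuousOnInterval G 0 1 →
      (∃ g : ℝ → ℝ, IsDensityOf g G) ∧
      ∀ g : ℝ → ℝ, IsDensityOf g G →
        ∫⁻ t in Set.Icc (0 : ℝ) 1, ENNReal.ofReal (g t) ^ k ≤
          limsup (fun s : ℝ =>
            limsup (fun j => ENNReal.ofReal (boxCorrelation k x s (N j))) atTop /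
              ENNReal.ofReal ((2 * s) ^ (k - 1))) atTop) := by
  obtain ⟨n, rfl⟩ : ∃ n, k = n + 2 := ⟨k - 2, by omega⟩
  refine ⟨?_, fun hac => ⟨exists_isDensityOf hG.monotoneOn hac, fun g hg => ?_⟩⟩
  · rintro (h | h) s hs
    · exact tendsto_boxCorrelation_of_not_absolutelyContinuous n hG h hs
    · exact tendsto_boxCorrelation_of_pos_zero n hG h hs
  -- It suffices to bound the integral by every `c` above the upper limit; such a `c` bounds the
  -- normalised correlations at all large scales.
  refine le_of_forall_gt_imp_ge_of_dense fun c hc => ?_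
  rcases eq_or_ne c ⊤ with rfl | hctop
  · exact le_top
  have hev := eventually_lt_of_limsup_lt hc
  obtain ⟨s₀, hs₀⟩ := ((hev.and (eventually_gt_atTop 0)).exists_forall_of_atTop)
  have hR : ∀ s, s₀ ≤ s → ∀ᶠ j in atTop,
      boxCorrelation (n + 2) x s (N j) ≤ c.toReal * (2 * s) ^ (n + 1) := by
    intro s hs
    obtain ⟨h1, hspos⟩ := hs₀ s hs
    have hpow : (0 : ℝ) < (2 * s) ^ (n + 1) := by positivity
    have h2 : limsup (fun j => ENNReal.ofReal (boxCorrelation (n + 2) x s (N j))) atTop <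
        c * ENNReal.ofReal ((2 * s) ^ (n + 1)) :=
      (ENNReal.div_lt_iff (Or.inl (ENNReal.ofReal_pos.2 hpow).ne')
        (Or.inl ENNReal.ofReal_ne_top)).1 h1
    filter_upwards [eventually_lt_of_limsup_lt h2] with j hj
    rw [← ENNReal.ofReal_toReal hctop, ← ENNReal.ofReal_mul ENNReal.toReal_nonneg] at hj
    exact (ENNReal.ofReal_le_ofReal_iff (by positivity)).1 hj.le
  rw [← ENNReal.ofReal_toReal hctop]
  have hmem : ∀ m l : ℕ, l < m → (0 : ℝ) ≤ (l : ℝ) / m ∧ (l : ℝ) / m < (l + 1) / m ∧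
      ((l : ℝ) + 1) / m ≤ 1 := by
    intro m l hl
    have hm : (0 : ℝ) < m := by exact_mod_cast (Nat.zero_le l).trans_lt hl
    refine ⟨by positivity, by gcongr; linarith, ?_⟩
    rw [div_le_one hm]
    exact_mod_cast hl
  refine hg.lintegral_pow_le (n + 2) ?_ ?_
  · intro m l hl
    obtain ⟨h0, h1, h2⟩ := hmem m l hl
    exact mul_nonneg (Nat.cast_nonneg m) (sub_nonneg.2
      (hG.monotoneOn ⟨h0, h1.le.trans h2⟩ ⟨h0.trans h1.le, h2⟩ h1.le))
  · intro m hm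
    have hm' : (0 : ℝ) < m := by exact_mod_cast hm
    refine le_trans (le_of_eq ?_) (sum_moment_le_of_boxCorrelation_le n hG ENNReal.toReal_nonneg hR
      (Finset.range m) (fun l => (l : ℝ) / m) (fun l => ((l : ℝ) + 1) / m)
      (fun l hl => (hmem m l (Finset.mem_range.1 hl)).1)
      (fun l hl => (hmem m l (Finset.mem_range.1 hl)).2.1)
      (fun l hl => (hmem m l (Finset.mem_range.1 hl)).2.2) (pairwiseDisjoint_Ioc_div hm _))
    refine Finset.sum_congr rfl fun l _ => ?_
    have hlen : ((l : ℝ) + 1) / m - l / m = 1 / m := by ring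
    rw [hlen, stepSlope, div_div_eq_mul_div, div_one, mul_comm (m : ℝ)]
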